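/- Let $G$ be a second-countable locally compact group, let $A$ be a separable and $B$ a $\sigma$-unital $C^*$-algebra, and let $\alpha: G\curvearrowright A$ and $\beta: G\curvearrowright B$ be point-norm continuous actions by $*$-automorphisms. Write $\beta_g$ also for the canonical extension of $\beta_g$ to the multiplier algebra $\mathcal M(B)$. A cocycle representation $(\varphi,\mathbb u):(A,\alpha)\to(\mathcal M(B),\beta)$ consists of a $*$-homomorphism $\varphi: A\to\mathcal M(B)$ and a strictly continuous map $\mathbb u: G\to\mathcal U(\mathcal M(B))$ with $\mathbb u_{gh}=\mathbb u_g\beta_g(\mathbb u_h)$ for all $g,h\in G$ and $\mathbb u_g\beta_g(\varphi(a))\mathbb u_g^*=\varphi(\alpha_g(a))$ for all $g\in G$, $a\in A$. Let $D_{(\varphi,\mathbb u)}$ be the unital $C^*$-subalgebra of all $x\in\mathcal M(B)$ such that $x-\mathbb u_g\beta_g(x)\mathbb u_g^*\in B$ for all $g\in G$ and $x\varphi(a)-\varphi(a)x\in B$ for all $a\in A$. Two cocycle representations $(\varphi,\mathbb u),(\psi,\mathbb v):(A,\alpha)\to(\mathcal M(B),\beta)$ are called operator homotopic if there is a unitary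 $w$ in the norm-connected component of $1$ in the unitary group of $D_{(\varphi,\mathbb u)}$ such that $\psi(a)=w\varphi(a)w^*$ for all $a\in A$ and $\mathbb v_g=w\mathbb u_g\beta_g(w)^*$ for all $g\in G$. Let $(\varphi,\mathbb u),(\psi,\mathbb v):(A,\alpha)\to(\mathcal M(B),\beta)$ be operator homotopic cocycle representations. Then they are strongly asymptotically unitarily equivalent: writing $\mathcal U(1+B)$ for the set of unitaries with scalar part $1$ in the $C^*$-algebra obtained from $B$ by adjoining a new unit, mapped canonically to $\mathcal M(B)$, there is a norm-continuous path $w:[0,\infty)\to\mathcal U(1+B)$ with $w_0=1$ such that \[ \lim_{t\to\infty}\|\psi(a)-w_t\varphi(a)w_t^*\|=0 \quad\text{for all } a\in A \] and \[ \lim_{t\to\infty}\ \sup_{g\in K}\|\mathbb v_g-w_t\mathbb u_g\beta_g(w_t)^*\|=0 \quad\text{for every compact set } K\subseteq G. \] -/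

import Mathlib

open Filter Topology
open scoped NNReal MultiplierAlgebra

noncomputable section

namespace CocycleRepresentations

/-- A C⋆-algebra is σ-unital if it has a sequential approximate unit, i.e. an increasing sequence
of positive contractions `e n` with `e n * b → b` and `b * e n → b` in norm for all `b`. -/
def IsSigmaUnital (B : Type*) [NonUnitalCStarAlgebra B] : Prop :=
  letI := CStarAlgebra.spectralOrder B
  ∃ e : ℕ → B, Monotone e ∧ (∀ n, 0 ≤ e n ∧ ‖e n‖ ≤ 1) ∧
    ∀ b : B, Tendsto (fun n => e n * b) atTop (𝓝 b) ∧ Tendsto (fun n => b * e n) atTop (𝓝 b)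

/-- A point-norm continuous action of a topological group on a C⋆-algebra by
⋆-automorphisms. -/
structure ContAction (G : Type*) [Group G] [TopologicalSpace G]
    (A : Type*) [NonUnitalCStarAlgebra A] where
  /-- The homomorphism into the automorphism group. -/
  aut : G →* (A ≃⋆ₐ[ℂ] A)
  /-- Continuity of all orbit maps for the norm. -/
  continuous_orbit : ∀ a : A, Continuous fun g => aut g a

section Multipliers

variable {B : Type*} [NonUnitalCStarAlgebra B]

/-- A ⋆-automorphism of a C⋆-algebra as a continuous linear map. -/
def autCLM (σ : B ≃⋆ₐ[ℂ] B) : B →L[ℂ] B where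
  toFun := σ
  map_add' := map_add σ
  map_smul' := map_smul σ
  cont := (NonUnitalStarAlgHom.isometry σ σ.injective).continuous

@[simp] lemma autCLM_apply (σ : B ≃⋆ₐ[ℂ] B) (b : B) : autCLM σ b = σ b := rfl

lemma multiplier_ext {x y : 𝓜(ℂ, B)} (h₁ : ∀ b, x.fst b = y.fst b)
    (h₂ : ∀ b, x.snd b = y.snd b) : x = y :=
  DoubleCentralizer.ext _ _ _ _ (Prod.ext (ContinuousLinearMap.ext h₁) (ContinuousLinearMap.ext h₂))

/-- The canonical extension of a ⋆-automorphism `σ` of `B` to the multiplier algebra of `B`: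
`σ(x) b = σ (x σ⁻¹(b))` and `b σ(x) = σ (σ⁻¹(b) x)`. -/
def multiplierExt (σ : B ≃⋆ₐ[ℂ] B) : 𝓜(ℂ, B) →⋆ₐ[ℂ] 𝓜(ℂ, B) where
  toFun x :=
    { fst := (autCLM σ).comp (x.fst.comp (autCLM σ.symm))
      snd := (autCLM σ).comp (x.snd.comp (autCLM σ.symm))
      central := fun a b => by
        have h := congrArg σ (x.central (σ.symm a) (σ.symm b))
        simpa using h }
  map_one' := multiplier_ext (fun b => by simp) (fun b => by simp)
  map_mul' x y := multiplier_ext (fun b => by simp) (fun b => by simp)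
  map_zero' := multiplier_ext (fun b => by simp) (fun b => by simp)
  map_add' x y := multiplier_ext (fun b => by simp) (fun b => by simp)
  commutes' c := multiplier_ext
    (fun b => by simp [Algebra.algebraMap_eq_smul_one])
    (fun b => by simp [Algebra.algebraMap_eq_smul_one])
  map_star' x := multiplier_ext (fun b => by simp [map_star]) (fun b => by simp [map_star])

/-- The copy of `B` inside its multiplier algebra. -/
def baseIdeal (B : Type*) [NonUnitalCStarAlgebra B] : NonUnitalStarSubalgebra ℂ 𝓜(ℂ, B) :=
  NonUnitalStarAlgHom.range (DoubleCentralizer.coeHom (𝕜 := ℂ) (A := B))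

lemma mul_mem_baseIdeal (x : 𝓜(ℂ, B)) {y : 𝓜(ℂ, B)} (hy : y ∈ baseIdeal B) :
    x * y ∈ baseIdeal B := by
  obtain ⟨b, rfl⟩ := hy
  refine ⟨x.fst b, multiplier_ext (fun c => ?_) (fun c => ?_)⟩
  · change x.fst b * c = x.fst (b * c)
    rw [← sub_eq_zero, ← CStarRing.star_mul_self_eq_zero_iff]
    generalize star (x.fst b * c - x.fst (b * c)) = d
    rw [mul_sub, ← mul_assoc, ← x.central, ← x.central, mul_assoc, sub_self]
  · exact (x.central c b).symm

lemma mem_baseIdeal_mul {y : 𝓜(ℂ, B)} (hy : y ∈ baseIdeal B) (x : 𝓜(ℂ, B)) :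
    y * x ∈ baseIdeal B := by
  simpa using star_mem (mul_mem_baseIdeal (star x) (star_mem hy))

/-- The proper unitization of `B` (a new unit is added even if `B` is unital) mapped canonically
to the multiplier algebra, `(c, b) ↦ c 1 + b`. -/
def unitizationToMultiplier (B : Type*) [NonUnitalCStarAlgebra B] :
    Unitization ℂ B →⋆ₐ[ℂ] 𝓜(ℂ, B) :=
  Unitization.starLift (DoubleCentralizer.coeHom (𝕜 := ℂ) (A := B))

/-- The set `U(1 + B)` of all unitaries in the proper unitization of `B` with scalar part `1`. -/
def unitariesOnePlus (B : Type*) [NonUnitalCStarAlgebra B] : Set (unitary (Unitization ℂ B)) :=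
  {u | (u : Unitization ℂ B).fst = 1}

end Multipliers

variable {G : Type*} [Group G] [TopologicalSpace G]
variable {A : Type*} [NonUnitalCStarAlgebra A] {B : Type*} [NonUnitalCStarAlgebra B]

/-- A cocycle representation `(φ, u) : (A, α) → (M(B), β)`. -/
structure CocycleRep (α : ContAction G A) (β : ContAction G B) where
  /-- The ⋆-homomorphism `φ : A → M(B)`. -/
  hom : A →⋆ₙₐ[ℂ] 𝓜(ℂ, B)
  /-- The unitary cocycle `u : G → U(M(B))`. -/
  coc : G → unitary 𝓜(ℂ, B)
  /-- Strict continuity of the cocycle: `g ↦ u_g b` is norm-continuous for all `b ∈ B`. -/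
  continuous_coc_mul : ∀ b : B, Continuous fun g => (coc g : 𝓜(ℂ, B)).fst b
  /-- Strict continuity of the cocycle: `g ↦ b u_g` is norm-continuous for all `b ∈ B`. -/
  continuous_mul_coc : ∀ b : B, Continuous fun g => (coc g : 𝓜(ℂ, B)).snd b
  /-- The cocycle identity `u_{gh} = u_g β_g(u_h)`. -/
  coc_mul : ∀ g h : G, (coc (g * h) : 𝓜(ℂ, B)) = coc g * multiplierExt (β.aut g) (coc h)
  /-- Equivariance `Ad(u_g) ∘ β_g ∘ φ = φ ∘ α_g`. -/
  equivariant : ∀ (g : G) (a : A),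
    (coc g : 𝓜(ℂ, B)) * multiplierExt (β.aut g) (hom a) * star (coc g : 𝓜(ℂ, B))
      = hom (α.aut g a)

namespace CocycleRep

variable {α : ContAction G A} {β : ContAction G B}

/-- The cocycle perturbed action `β^u_g = Ad(u_g) ∘ β_g`, on the multiplier algebra. -/
def perturbed (ρ : CocycleRep α β) (g : G) (x : 𝓜(ℂ, B)) : 𝓜(ℂ, B) :=
  (ρ.coc g : 𝓜(ℂ, B)) * multiplierExt (β.aut g) x * star (ρ.coc g : 𝓜(ℂ, B))

lemma perturbed_algebraMap (ρ : CocycleRep α β) (g : G) (c : ℂ) :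
    ρ.perturbed g (algebraMap ℂ _ c) = algebraMap ℂ _ c := by
  rw [perturbed, AlgHomClass.commutes, ← Algebra.commutes, mul_assoc, Unitary.mul_star_self_of_mem (ρ.coc g).2,
    mul_one]

lemma perturbed_add (ρ : CocycleRep α β) (g : G) (x y : 𝓜(ℂ, B)) :
    ρ.perturbed g (x + y) = ρ.perturbed g x + ρ.perturbed g y := by
  simp [perturbed, mul_add, add_mul]

lemma perturbed_mul (ρ : CocycleRep α β) (g : G) (x y : 𝓜(ℂ, B)) :
    ρ.perturbed g (x * y) = ρ.perturbed g x * ρ.perturbed g y := by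
  have h : star (ρ.coc g : 𝓜(ℂ, B)) * (ρ.coc g : 𝓜(ℂ, B)) = 1 := Unitary.coe_star_mul_self _
  simp only [perturbed, map_mul]
  calc _ = (ρ.coc g : 𝓜(ℂ, B)) * multiplierExt (β.aut g) x * 1 * multiplierExt (β.aut g) y
        * star (ρ.coc g : 𝓜(ℂ, B)) := by simp only [mul_one, mul_assoc]
    _ = _ := by rw [← h]; simp only [mul_assoc]

lemma perturbed_star (ρ : CocycleRep α β) (g : G) (x : 𝓜(ℂ, B)) :
    ρ.perturbed g (star x) = star (ρ.perturbed g x) := by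
  simp [perturbed, map_star, mul_assoc]

/-- The C⋆-algebra `D_{(φ,u)}` of all `x ∈ M(B)` such that `x - β^u_g(x) ∈ B` for all `g ∈ G` and
`x φ(a) - φ(a) x ∈ B` for all `a ∈ A`. -/
def dAlg (ρ : CocycleRep α β) : StarSubalgebra ℂ 𝓜(ℂ, B) where
  carrier := {x | (∀ g : G, x - ρ.perturbed g x ∈ baseIdeal B) ∧
    ∀ a : A, x * ρ.hom a - ρ.hom a * x ∈ baseIdeal B}
  mul_mem' := by
    rintro x y ⟨hx, hx'⟩ ⟨hy, hy'⟩
    refine ⟨fun g => ?_, fun a => ?_⟩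
    · have h := add_mem (mem_baseIdeal_mul (hx g) y)
        (mul_mem_baseIdeal (ρ.perturbed g x) (hy g))
      rw [perturbed_mul]
      convert h using 1
      noncomm_ring
    · have h := add_mem (mul_mem_baseIdeal x (hy' a)) (mem_baseIdeal_mul (hx' a) y)
      convert h using 1
      noncomm_ring
  add_mem' := by
    rintro x y ⟨hx, hx'⟩ ⟨hy, hy'⟩
    refine ⟨fun g => ?_, fun a => ?_⟩
    · rw [perturbed_add, add_sub_add_comm]
      exact add_mem (hx g) (hy g)
    · rw [add_mul, mul_add, add_sub_add_comm]
      exact add_mem (hx' a) (hy' a)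
  algebraMap_mem' c := by
    refine ⟨fun g => ?_, fun a => ?_⟩
    · rw [perturbed_algebraMap, sub_self]
      exact zero_mem _
    · rw [Algebra.commutes, sub_self]
      exact zero_mem _
  star_mem' := by
    rintro x ⟨hx, hx'⟩
    refine ⟨fun g => ?_, fun a => ?_⟩
    · rw [perturbed_star, ← star_sub]
      exact star_mem (hx g)
    · have h := neg_mem (star_mem (hx' (star a)))
      rw [star_sub, star_mul, star_mul, map_star, star_star, neg_sub] at h
      exact h

/-- `(φ, u)` and `(ψ, v)` are operator homotopic: there is a unitary `w` in the norm-connected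
component of `1` in the unitary group of `D_{(φ,u)}` with `ψ = Ad(w) ∘ φ` and
`v_g = w u_g β_g(w)⋆` for all `g ∈ G`. -/
def OperatorHomotopic (ρ₀ ρ₁ : CocycleRep α β) : Prop :=
  ∃ w : unitary ρ₀.dAlg, w ∈ connectedComponent (1 : unitary ρ₀.dAlg) ∧
    (∀ a : A, ρ₁.hom a = ((w : ρ₀.dAlg) : 𝓜(ℂ, B)) * ρ₀.hom a *
      star ((w : ρ₀.dAlg) : 𝓜(ℂ, B))) ∧
    ∀ g : G, (ρ₁.coc g : 𝓜(ℂ, B)) = ((w : ρ₀.dAlg) : 𝓜(ℂ, B)) * ρ₀.coc g *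
      star (multiplierExt (β.aut g) ((w : ρ₀.dAlg) : 𝓜(ℂ, B)))

/-- `(φ, u)` and `(ψ, v)` are strongly asymptotically unitarily equivalent: there is a
norm-continuous path `w : [0,∞) → U(1 + B)` with `w_0 = 1` such that `w_t φ(a) w_t⋆ → ψ(a)` for all
`a ∈ A`, and `w_t u_g β_g(w_t)⋆ → v_g` uniformly in `g` on each compact subset of `G`. -/
def StronglyAsymptoticallyUnitarilyEquivalent (ρ₀ ρ₁ : CocycleRep α β) : Prop :=
  ∃ w : ℝ≥0 → unitary (Unitization ℂ B),
    Continuous w ∧ (∀ t, w t ∈ unitariesOnePlus B) ∧ w 0 = 1 ∧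
    (∀ a : A, Tendsto (fun t => ‖ρ₁.hom a - unitizationToMultiplier B (w t) * ρ₀.hom a *
      star (unitizationToMultiplier B (w t))‖) atTop (𝓝 0)) ∧
    ∀ K : Set G, IsCompact K → ∀ ε > (0 : ℝ), ∀ᶠ t in atTop, ∀ g ∈ K,
      ‖(ρ₁.coc g : 𝓜(ℂ, B)) - unitizationToMultiplier B (w t) * ρ₀.coc g *
        star (multiplierExt (β.aut g) (unitizationToMultiplier B (w t)))‖ < ε

end CocycleRep

end CocycleRepresentations

end

/-! Write γ_g = Ad(u_g) ∘ β_g. It suffices to find a norm-continuous path of unitaries x_t in w* +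
B, starting at w*, that asymptotically commutes with φ(A) and is asymptotically γ-invariant,
uniformly on compact sets. Then w x_t lies in 1 + B, starts at 1, and up to unitary factors its two
errors are the commutator [x_t, φ(a)] and the displacement x_t - γ_g(x_t).

Such paths can be multiplied (`HasFixedPath.mul`), and w*, lying in the identity component, is a
finite product of exponentials exp(ih) with h selfadjoint in D. For one exponential the path is
exp(i(1-p_t)h(1-p_t)), where p_t ∈ B starts at 0 and is an approximate unit, quasicentral for φ(A)
and asymptotically γ-invariant (`exists_isQuasicentralPath`). It starts at exp(ih) and is constant
modulo B. As [h, φ(a)] and h - γ_g(h) lie in B, the factors 1-p_t annihilate them in the limit.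

Uniformity in g requires g ↦ h - γ_g(h) to be norm-continuous, which a Baire argument gives
(`continuous_sub_hom`). The elements p_t come from averaging an approximate unit: its commutators
and displacements are almost orthogonal along a sparse subsequence, so their averages are small
(`exists_norm_sum_le`). -/

noncomputable section

namespace CocycleRepresentations

/-! ### Perturbation of the exponential series -/

section Exponential

open NormedSpace

lemma norm_pow_succ_mul_sub_mul_pow_succ_le {R : Type*} [NormedRing R] {X Y : R} (c : R) {r : ℝ}
    (hX : ‖X‖ ≤ r) (hY : ‖Y‖ ≤ r) (n : ℕ) :
    ‖X ^ (n + 1) * c - c * Y ^ (n + 1)‖ ≤ (n + 1) * r ^ n * ‖X * c - c * Y‖ := by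
  have hr : 0 ≤ r := (norm_nonneg X).trans hX
  induction n with
  | zero => simp
  | succ n ih =>
    have hsplit : X ^ (n + 1 + 1) * c - c * Y ^ (n + 1 + 1) =
        X * (X ^ (n + 1) * c - c * Y ^ (n + 1)) + (X * c - c * Y) * Y ^ (n + 1) := by
      rw [pow_succ' X (n + 1), pow_succ' Y (n + 1)]
      noncomm_ring
    have hYn : ‖Y ^ (n + 1)‖ ≤ r ^ (n + 1) :=
      (norm_pow_le' Y n.succ_pos).trans (pow_le_pow_left₀ (norm_nonneg _) hY _)
    rw [hsplit]
    calc _ ≤ r * ((n + 1) * r ^ n * ‖X * c - c * Y‖) + ‖X * c - c * Y‖ * r ^ (n + 1) := by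
          refine (norm_add_le _ _).trans (add_le_add ?_ ?_)
          · exact (norm_mul_le _ _).trans (mul_le_mul hX ih (norm_nonneg _) hr)
          · exact (norm_mul_le _ _).trans (mul_le_mul_of_nonneg_left hYn (norm_nonneg _))
      _ = _ := by push_cast; ring

/-- The exponential almost intertwines what its arguments almost intertwine. -/
lemma norm_exp_mul_sub_mul_exp_le {R : Type*} [NormedRing R] [NormedAlgebra ℂ R] [CompleteSpace R]
    {X Y : R} (c : R) {r : ℝ} (hX : ‖X‖ ≤ r) (hY : ‖Y‖ ≤ r) :
    ‖exp X * c - c * exp Y‖ ≤ Real.exp r * ‖X * c - c * Y‖ := by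
  have h₁ := ((exp_series_hasSum_exp' (𝕂 := ℂ) X).mul_right c).sub
    ((exp_series_hasSum_exp' (𝕂 := ℂ) Y).mul_left c)
  -- The degree-zero term c - c is dropped. In degree n + 1 the factor n + 1 of the power estimate
  -- turns 1/(n+1)! into 1/n!.
  have h₂ := (hasSum_nat_add_iff' 1).mpr h₁
  have h₃ : HasSum (fun n : ℕ => (r ^ n / n.factorial) * ‖X * c - c * Y‖)
      (Real.exp r * ‖X * c - c * Y‖) := by
    rw [Real.exp_eq_exp_ℝ]
    exact (expSeries_div_hasSum_exp r).mul_right _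
  have h₄ := h₂.norm_le_of_bounded h₃ fun n => ?_
  · simpa using h₄
  · have h := norm_pow_succ_mul_sub_mul_pow_succ_le c hX hY n
    rw [smul_mul_assoc, mul_smul_comm, ← smul_sub, norm_smul]
    calc _ ≤ ‖((n + 1).factorial : ℂ)⁻¹‖ * ((n + 1) * r ^ n * ‖X * c - c * Y‖) := by gcongr
      _ = _ := by
        rw [norm_inv, Complex.norm_natCast, Nat.factorial_succ]
        push_cast
        have : (n.factorial : ℝ) ≠ 0 := by positivity
        have : (n : ℝ) + 1 ≠ 0 := by positivity
        field_simp

end Exponential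

/-! ### Closed ideals, compact families and small averages -/

section Ideal

open NormedSpace

variable {M : Type*} [CStarAlgebra M]

/-- `J` is a closed two-sided ideal. -/
structure IsClosedIdeal (J : NonUnitalStarSubalgebra ℂ M) : Prop where
  isClosed : IsClosed (J : Set M)
  mul_mem_left : ∀ (x : M) {y : M}, y ∈ J → x * y ∈ J
  mul_mem_right : ∀ {y : M}, y ∈ J → ∀ x : M, y * x ∈ J

lemma norm_one_le (M : Type*) [CStarAlgebra M] : ‖(1 : M)‖ ≤ 1 := by
  rcases subsingleton_or_nontrivial M with h | h
  · simp [Subsingleton.elim (1 : M) 0]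
  · simp

lemma norm_unitary_le (u : unitary M) : ‖(u : M)‖ ≤ 1 := by
  rw [← mul_one (u : M), CStarRing.norm_coe_unitary_mul]
  exact norm_one_le M

/-- The bound is 2 rather than 1 because f need not be positive. -/
lemma norm_one_sub_le {f : M} (hf : ‖f‖ ≤ 1) : ‖1 - f‖ ≤ 2 :=
  (norm_sub_le _ _).trans (by linarith [norm_one_le M])

variable {J : NonUnitalStarSubalgebra ℂ M}

/-- Powers of X and Y agree modulo J, hence so do the partial sums of the two series, and J is
closed. -/
lemma IsClosedIdeal.exp_sub_exp_mem (hJ : IsClosedIdeal J) {X Y : M} (h : X - Y ∈ J) :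
    exp X - exp Y ∈ J := by
  have hpow : ∀ n : ℕ, X ^ n - Y ^ n ∈ J := fun n => by
    induction n with
    | zero => simp
    | succ n ih =>
      have h' := add_mem (hJ.mul_mem_left X ih) (hJ.mul_mem_right h (Y ^ n))
      convert h' using 1
      rw [pow_succ', pow_succ']
      noncomm_ring
  have hs := (exp_series_hasSum_exp' (𝕂 := ℂ) X).sub (exp_series_hasSum_exp' (𝕂 := ℂ) Y)
  refine hJ.isClosed.mem_of_tendsto hs (Eventually.of_forall fun s => sum_mem fun n _ => ?_)
  rw [← smul_sub]
  exact SMulMemClass.smul_mem _ (hpow n)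

/-- A uniformly bounded net that tends to zero strictly tends to zero uniformly on compact families
in the ideal. -/
lemma eventually_norm_mul_le_of_isCompact {ι G : Type*} [TopologicalSpace G] {l : Filter ι}
    {q : ι → M} {C : ℝ} (hqC : ∀ i, ‖q i‖ ≤ C) (hq : ∀ b ∈ J, Tendsto (fun i => q i * b) l (𝓝 0))
    {K : Set G} (hK : IsCompact K) {b : G → M} (hb : Continuous b) (hbJ : ∀ g, b g ∈ J)
    {ε : ℝ} (hε : 0 < ε) : ∀ᶠ i in l, ∀ g ∈ K, ‖q i * b g‖ ≤ ε := by
  refine hK.induction_on (p := fun s => ∀ᶠ i in l, ∀ g ∈ s, ‖q i * b g‖ ≤ ε) (by simp)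
    (fun s t hst ht => ht.mono fun i hi g hg => hi g (hst hg)) (fun s t hs ht => ?_)
    fun x _ => ?_
  · filter_upwards [hs, ht] with i h₁ h₂ g hg
    exact hg.elim (h₁ g) (h₂ g)
  · have hC : 0 < |C| + 1 := by positivity
    have hδ : 0 < ε / 2 / (|C| + 1) := by positivity
    refine ⟨_, mem_nhdsWithin_of_mem_nhds (hb.continuousAt (Metric.closedBall_mem_nhds (b x) hδ)),
      ?_⟩
    have h₁ := (hq (b x) (hbJ x)).norm
    rw [norm_zero] at h₁
    filter_upwards [h₁.eventually (ge_mem_nhds (half_pos hε))] with i hi g hg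
    have hg' : ‖b g - b x‖ ≤ ε / 2 / (|C| + 1) := by simpa [dist_eq_norm] using hg
    calc ‖q i * b g‖ = ‖q i * (b g - b x) + q i * b x‖ := by rw [mul_sub, sub_add_cancel]
      _ ≤ (|C| + 1) * (ε / 2 / (|C| + 1)) + ε / 2 := by
        refine (norm_add_le _ _).trans (add_le_add ((norm_mul_le _ _).trans ?_) hi)
        exact mul_le_mul ((hqC i).trans ((le_abs_self C).trans (by linarith))) hg'
          (norm_nonneg _) hC.le
      _ = ε := by field_simp; ring

/-- In a bounded sequence (uniformly for a family of sequences) whose terms become orthogonal to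
each fixed term, there are averages of small norm. -/
lemma exists_norm_sum_le {𝒟 : Set (ℕ → M)} {C : ℝ} (hC : ∀ d ∈ 𝒟, ∀ n, ‖d n‖ ≤ C)
    (horth : ∀ m, ∀ ε > (0 : ℝ), ∀ᶠ n in atTop, ∀ d ∈ 𝒟, ‖star (d n) * d m‖ ≤ ε)
    (N₀ : ℕ) {ε : ℝ} (hε : 0 < ε) :
    ∃ (N : ℕ) (k : ℕ → ℕ), 0 < N ∧ (∀ j, N₀ ≤ k j) ∧
      ∀ d ∈ 𝒟, ‖∑ j ∈ Finset.range N, d (k j)‖ ≤ N * ε := by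
  -- By the C⋆-identity the squared norm of the sum is at most N C² from the diagonal plus N² ε²/2
  -- from all pairs. The first is at most N² ε²/2 once N exceeds C² / (ε²/2).
  have hδ : 0 < ε ^ 2 / 2 := by positivity
  obtain ⟨k, hk, hkr⟩ := exists_seq_of_forall_finset_exists (fun n => N₀ ≤ n)
    (fun m n => ∀ d ∈ 𝒟, ‖star (d n) * d m‖ ≤ ε ^ 2 / 2) fun s _ => by
      have h := (eventually_ge_atTop N₀).and
        ((Finset.eventually_all s).mpr fun m _ => horth m _ hδ)
      exact h.exists
  obtain ⟨N, hN⟩ := exists_nat_gt (C ^ 2 / (ε ^ 2 / 2))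
  have hN0 : (0 : ℝ) < N := lt_of_le_of_lt (by positivity) hN
  refine ⟨N, k, by exact_mod_cast hN0, hk, fun d hd => ?_⟩
  have hterm : ∀ i j : ℕ, ‖star (d (k i)) * d (k j)‖ ≤ (if i = j then C ^ 2 else 0) + ε ^ 2 / 2 := by
    intro i j
    rcases lt_trichotomy i j with h | h | h
    · rw [if_neg h.ne, zero_add]
      have := hkr i j h d hd
      rwa [← norm_star, star_mul, star_star] at this
    · subst h
      rw [if_pos rfl, CStarRing.norm_star_mul_self, ← sq]
      have := pow_le_pow_left₀ (norm_nonneg _) (hC d hd (k i)) 2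
      linarith
    · rw [if_neg h.ne', zero_add]
      exact hkr j i h d hd
  have hsq : ‖∑ j ∈ Finset.range N, d (k j)‖ ^ 2 ≤ (N * ε) ^ 2 := by
    rw [sq, ← CStarRing.norm_star_mul_self, star_sum, Finset.sum_mul_sum]
    calc _ ≤ ∑ i ∈ Finset.range N, ∑ j ∈ Finset.range N,
          ((if i = j then C ^ 2 else 0) + ε ^ 2 / 2) :=
          norm_sum_le_of_le _ fun i _ => norm_sum_le_of_le _ fun j _ => hterm i j
      _ = N * C ^ 2 + N * (N * (ε ^ 2 / 2)) := by
        simp only [Finset.sum_add_distrib, Finset.sum_ite_eq, Finset.sum_const, Finset.card_range,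
          nsmul_eq_mul]
        congr 1
        rw [Finset.sum_congr rfl fun i hi => if_pos hi]
        simp
      _ ≤ _ := by
        rw [div_lt_iff₀ hδ] at hN
        nlinarith
  exact le_of_sq_le_sq hsq (by positivity)

end Ideal

/-! ### Interpolation and joint continuity -/

/-- Piecewise linear interpolation of a sequence. -/
lemma exists_continuous_interpolation {V : Type*} [NormedAddCommGroup V] [NormedSpace ℝ V]
    (F : ℕ → V) : ∃ p : ℝ≥0 → V, Continuous p ∧ p 0 = F 0 ∧
      ∀ (n : ℕ) (C : Set V), Convex ℝ C → (∀ k ≥ n, F k ∈ C) → ∀ t ≥ (n : ℝ≥0), p t ∈ C := by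
  -- The coefficient `c t k` ramps from 0 to 1 over [k, k+1]. The sums `P n` stabilise on t ≤ n, so
  -- the path is locally a single `P n`.
  let c : ℝ≥0 → ℕ → ℝ := fun t k => max 0 (min 1 ((t : ℝ) - k))
  let P : ℕ → ℝ≥0 → V := fun n t => F 0 + ∑ k ∈ Finset.range n, c t k • (F (k + 1) - F k)
  have hP : ∀ n, Continuous (P n) := fun n => by fun_prop
  have hc0 : ∀ (t : ℝ≥0) (k : ℕ), t ≤ k → c t k = 0 := fun t k h => by
    have h' : (t : ℝ) ≤ k := by exact_mod_cast h
    exact max_eq_left ((min_le_right _ _).trans (by linarith))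
  have hc1 : ∀ (t : ℝ≥0) (k : ℕ), (k + 1 : ℝ≥0) ≤ t → c t k = 1 := fun t k h => by
    have h' : (k + 1 : ℝ) ≤ t := by exact_mod_cast h
    simp only [c]
    rw [min_eq_left (by linarith), max_eq_right zero_le_one]
  have hPP : ∀ (n m : ℕ) (t : ℝ≥0), t ≤ n → n ≤ m → P m t = P n t := fun n m t hn hm => by
    induction m, hm using Nat.le_induction with
    | base => rfl
    | succ m hm ih =>
      rw [← ih]
      simp only [P]
      rw [Finset.sum_range_succ, hc0 t m (hn.trans (by exact_mod_cast hm)), zero_smul, add_zero]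
  have hfl : ∀ t : ℝ≥0, t ≤ (⌊t⌋₊ + 1 : ℕ) := fun t => by
    push_cast
    exact (Nat.lt_floor_add_one t).le
  refine ⟨fun t => P (⌊t⌋₊ + 1) t, ?_, by simp [P, c], fun n C hC hF t ht => ?_⟩
  · refine continuous_iff_continuousAt.mpr fun t => ?_
    obtain ⟨n, hn⟩ := exists_nat_gt t
    refine ((hP n).continuousAt).congr ?_
    filter_upwards [gt_mem_nhds hn] with s hs
    rcases le_total n (⌊s⌋₊ + 1) with h | h
    · exact (hPP n _ s hs.le h).symm
    · exact hPP _ n s (hfl s) h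
  · set k := ⌊t⌋₊ with hk
    have hkt : (k : ℝ≥0) ≤ t := Nat.floor_le zero_le
    have hnk : n ≤ k := Nat.le_floor ht
    have hsum : ∑ j ∈ Finset.range k, c t j • (F (j + 1) - F j) = F k - F 0 := by
      rw [← Finset.sum_range_sub F k]
      refine Finset.sum_congr rfl fun j hj => ?_
      rw [hc1 t j (le_trans (by exact_mod_cast Finset.mem_range.mp hj) hkt), one_smul]
    have hp : P (k + 1) t = F k + c t k • (F (k + 1) - F k) := by
      simp only [P]
      rw [Finset.sum_range_succ, hsum]
      abel
    change P (k + 1) t ∈ C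
    rw [hp]
    exact hC.add_smul_sub_mem (hF k hnk) (hF (k + 1) (by omega))
      ⟨le_max_left _ _, max_le zero_le_one (min_le_left _ _)⟩

/-- Contractions are equicontinuous, so pointwise continuity suffices. It is asked only on S because
the actions are norm-continuous only on the ideal. -/
lemma continuous_apply_of_contractive {X V : Type*} [TopologicalSpace X] [PseudoMetricSpace V]
    {T : X → V → V} {S : Set V} (hT : ∀ x a b, dist (T x a) (T x b) ≤ dist a b)
    (hc : ∀ b ∈ S, Continuous fun x => T x b) {b : X → V} (hb : Continuous b)
    (hbS : ∀ x, b x ∈ S) : Continuous fun x => T x (b x) := by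
  refine continuous_iff_continuousAt.mpr fun x₀ => tendsto_iff_dist_tendsto_zero.mpr ?_
  have h₁ := tendsto_iff_dist_tendsto_zero.mp (hb.tendsto x₀)
  have h₂ := tendsto_iff_dist_tendsto_zero.mp ((hc (b x₀) (hbS x₀)).tendsto x₀)
  refine squeeze_zero (fun _ => dist_nonneg) (fun x => ?_) (by simpa using h₁.add h₂)
  exact (dist_triangle _ (T x (b x₀)) _).trans (add_le_add_left (hT x _ _) _)

open scoped CStarAlgebra

/-- The group homomorphism between unitary groups induced by a unital ⋆-homomorphism. -/
def unitaryMap {R S : Type*} [Ring R] [Algebra ℂ R] [StarRing R] [Ring S] [Algebra ℂ S] [StarRing S]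
    (f : R →⋆ₐ[ℂ] S) : unitary R →* unitary S where
  toFun u := ⟨f u, Unitary.map_mem f u.2⟩
  map_one' := Subtype.ext (map_one f)
  map_mul' _ _ := Subtype.ext (map_mul f _ _)

/-! ### Actions on an algebra with an invariant ideal -/

section Action

variable {M : Type*} [CStarAlgebra M] {J : NonUnitalStarSubalgebra ℂ M}
  {G : Type*} [Group G] [TopologicalSpace G]

/-- An action of `G` on `M` by unital ⋆-homomorphisms that leaves `J` invariant and is point-norm
continuous on `J`. -/
structure IdealAction (G : Type*) [Group G] [TopologicalSpace G]
    (J : NonUnitalStarSubalgebra ℂ M) where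
  hom : G → M →⋆ₐ[ℂ] M
  hom_one : ∀ x, hom 1 x = x
  hom_mul : ∀ g h x, hom (g * h) x = hom g (hom h x)
  hom_mem : ∀ g {x}, x ∈ J → hom g x ∈ J
  continuous_hom : ∀ b ∈ J, Continuous fun g => hom g b

/-- A sequential approximate unit of `J` consisting of selfadjoint contractions. -/
structure IsApproxUnit (J : NonUnitalStarSubalgebra ℂ M) (e : ℕ → M) : Prop where
  mem : ∀ n, e n ∈ J
  isSelfAdjoint : ∀ n, IsSelfAdjoint (e n)
  norm_le : ∀ n, ‖e n‖ ≤ 1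
  tendsto_mul : ∀ b ∈ J, Tendsto (fun n => e n * b) atTop (𝓝 b)

lemma IsApproxUnit.tendsto_mul' {e : ℕ → M} (he : IsApproxUnit J e) {b : M} (hb : b ∈ J) :
    Tendsto (fun n => b * e n) atTop (𝓝 b) := by
  have h := (he.tendsto_mul (star b) (star_mem hb)).star
  simpa [(he.isSelfAdjoint _).star_eq] using h

lemma IsApproxUnit.tendsto_one_sub_mul {e : ℕ → M} (he : IsApproxUnit J e) {b : M} (hb : b ∈ J) :
    Tendsto (fun n => (1 - e n) * b) atTop (𝓝 0) := by
  simpa [sub_mul] using (he.tendsto_mul b hb).const_sub b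

namespace IdealAction

variable (γ : IdealAction G J)

lemma hom_hom_inv (g : G) (x : M) : γ.hom g (γ.hom g⁻¹ x) = x := by
  rw [← γ.hom_mul, mul_inv_cancel, γ.hom_one]

lemma hom_inv_hom (g : G) (x : M) : γ.hom g⁻¹ (γ.hom g x) = x := by
  rw [← γ.hom_mul, inv_mul_cancel, γ.hom_one]

lemma norm_hom_le (g : G) (x : M) : ‖γ.hom g x‖ ≤ ‖x‖ := NonUnitalStarAlgHom.norm_apply_le _ x

lemma norm_hom (g : G) (x : M) : ‖γ.hom g x‖ = ‖x‖ :=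
  (γ.norm_hom_le g x).antisymm (by simpa [hom_inv_hom] using γ.norm_hom_le g⁻¹ (γ.hom g x))

lemma continuous_hom_apply {X : Type*} [TopologicalSpace X] {k : X → G} (hk : Continuous k)
    {b : X → M} (hb : Continuous b) (hbJ : ∀ x, b x ∈ J) :
    Continuous fun x => γ.hom (k x) (b x) :=
  continuous_apply_of_contractive (S := J) (T := fun x => γ.hom (k x))
    (fun x a b => by rw [dist_eq_norm, dist_eq_norm, ← map_sub]; exact γ.norm_hom_le _ _)
    (fun b hb => (γ.continuous_hom b hb).comp hk) hb hbJ

/-- The orbit of h need not be norm-continuous, but γ_g(h) b = γ_g(h γ_{g⁻¹}(b)) and h γ_{g⁻¹}(b)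
lies in J. -/
lemma continuous_hom_mul [IsTopologicalGroup G] (hJ : IsClosedIdeal J) (h : M) {b : M}
    (hb : b ∈ J) : Continuous fun g => γ.hom g h * b := by
  have h₁ : Continuous fun g => γ.hom g (h * γ.hom g⁻¹ b) :=
    γ.continuous_hom_apply continuous_id
      (continuous_const.mul ((γ.continuous_hom b hb).comp continuous_inv))
      fun g => hJ.mul_mem_left _ (γ.hom_mem _ hb)
  simpa [hom_hom_inv] using h₁

/-- A cocycle `g ↦ h - γ_g(h)` with values in the ideal is automatically norm-continuous. -/
lemma continuous_sub_hom [IsTopologicalGroup G] [BaireSpace G] (hJ : IsClosedIdeal J) {e : ℕ → M}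
    (he : IsApproxUnit J e) {h : M} (hh : ∀ g, h - γ.hom g h ∈ J) :
    Continuous fun g => h - γ.hom g h := by
  set c : G → M := fun g => h - γ.hom g h with hc
  have hcoc : ∀ g k, c (g * k) - c g = γ.hom g (c k) := fun g k => by
    simp only [hc, γ.hom_mul, map_sub]
    abel
  have hcb : ∀ b ∈ J, Continuous fun g => c g * b := fun b hb => by
    simp only [hc, sub_mul]
    exact continuous_const.sub (γ.continuous_hom_mul hJ h hb)
  have hlim : Tendsto c (𝓝 1) (𝓝 0) := by
    refine tendsto_zero_iff_norm_tendsto_zero.mpr ?_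
    refine Metric.tendsto_nhds.mpr fun ε hε => ?_
    have hε4 : 0 < ε / 4 := by positivity
    -- Baire category: `F N` collects the g with c_g almost supported on `e N`. Testing against each
    -- `e m` keeps the products in J, where continuity in g is known, so `F N` is closed.
    let F : ℕ → Set G := fun N => {g | ∀ m, ‖c g * ((1 - e N) * e m)‖ ≤ ε / 4}
    have hF : ∀ N, IsClosed (F N) := fun N => by
      simp only [F, Set.ofPred_forall]
      exact isClosed_iInter fun m =>
        isClosed_le (hcb _ (hJ.mul_mem_left _ (he.mem m))).norm continuous_const
    have hFle : ∀ N, ∀ g ∈ F N, ‖c g - c g * e N‖ ≤ ε / 4 := fun N g hg => by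
      have hmem : c g - c g * e N ∈ J := sub_mem (hh g) (hJ.mul_mem_left _ (he.mem N))
      refine le_of_tendsto (he.tendsto_mul' hmem).norm (Eventually.of_forall fun m => ?_)
      have := hg m
      rwa [← mul_assoc, mul_sub, mul_one] at this
    have hFU : ⋃ N, F N = Set.univ := Set.eq_univ_of_forall fun g => by
      have h₁ := ((he.tendsto_mul' (hh g)).const_sub (c g)).norm
      rw [show c g - (h - γ.hom g h) = 0 from sub_self _, norm_zero] at h₁
      obtain ⟨N, hN⟩ := (h₁.eventually (ge_mem_nhds hε4)).exists
      refine Set.mem_iUnion.mpr ⟨N, fun m => ?_⟩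
      rw [← mul_assoc, mul_sub, mul_one]
      calc _ ≤ ‖c g - c g * e N‖ * ‖e m‖ := norm_mul_le _ _
        _ ≤ ε / 4 * 1 := mul_le_mul hN (he.norm_le m) (norm_nonneg _) hε4.le
        _ = ε / 4 := mul_one _
    obtain ⟨N, g₀, hg₀⟩ := nonempty_interior_of_iUnion_of_closed hF hFU
    have hmul : Tendsto (fun k => g₀ * k) (𝓝 1) (𝓝 g₀) := by
      simpa using (continuous_const_mul g₀).tendsto (1 : G)
    -- Near an interior point g₀ of `F N` both c(g₀k) and c(g₀) are close to their products with `e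
    -- N`, which vary continuously. The cocycle identity carries the estimate from g₀ to 1.
    have h₁ := hmul.eventually (mem_interior_iff_mem_nhds.mp hg₀)
    have h₂ := ((hcb _ (he.mem N)).tendsto g₀).comp hmul
    filter_upwards [h₁, Metric.tendsto_nhds.mp h₂ _ hε4] with k hk₁ hk₂
    have h₃ := hFle N _ hk₁
    have h₄ := hFle N _ (interior_subset hg₀)
    rw [dist_eq_norm] at hk₂
    rw [Real.dist_0_eq_abs, abs_norm, ← γ.norm_hom g₀, ← hcoc]
    calc ‖c (g₀ * k) - c g₀‖ = ‖(c (g₀ * k) - c (g₀ * k) * e N) +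
          (c (g₀ * k) * e N - c g₀ * e N) - (c g₀ - c g₀ * e N)‖ := by congr 1; abel
      _ ≤ ‖c (g₀ * k) - c (g₀ * k) * e N‖ + ‖c (g₀ * k) * e N - c g₀ * e N‖ +
          ‖c g₀ - c g₀ * e N‖ :=
        (norm_sub_le _ _).trans (add_le_add_left (norm_add_le _ _) _)
      _ < ε := by
        simp only [Function.comp_apply] at hk₂
        linarith
  refine continuous_iff_continuousAt.mpr fun g₀ => tendsto_iff_norm_sub_tendsto_zero.mpr ?_
  have hinv : Tendsto (fun g => g₀⁻¹ * g) (𝓝 g₀) (𝓝 1) := by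
    simpa using (continuous_const_mul g₀⁻¹).tendsto g₀
  refine (tendsto_zero_iff_norm_tendsto_zero.mp (hlim.comp hinv)).congr fun g => ?_
  rw [Function.comp_apply, ← γ.norm_hom g₀, ← hcoc, mul_inv_cancel_left]

/-- Averages of an approximate unit that are almost central and almost invariant. -/
lemma exists_quasicentral [IsTopologicalGroup G] (hJ : IsClosedIdeal J) {e : ℕ → M}
    (he : IsApproxUnit J e) {F : Set M} (hF : F.Finite) {K : Set G} (hK : IsCompact K)
    (N₀ : ℕ) {ε : ℝ} (hε : 0 < ε) :
    ∃ f ∈ J, IsSelfAdjoint f ∧ ‖f‖ ≤ 1 ∧ (∀ x ∈ F, ‖f * x - x * f‖ ≤ ε) ∧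
      (∀ g ∈ K, ‖γ.hom g f - f‖ ≤ ε) ∧
      ∀ (b : M) (δ : ℝ), (∀ n ≥ N₀, ‖e n * b - b‖ ≤ δ) → ‖f * b - b‖ ≤ δ := by
  obtain ⟨R, hR0, hR⟩ : ∃ R, 0 ≤ R ∧ ∀ x ∈ F, ‖x‖ ≤ R := by
    obtain ⟨R, hR⟩ := hF.isBounded.exists_norm_le
    exact ⟨max 0 R, le_max_left _ _, fun x hx => (hR x hx).trans (le_max_right _ _)⟩
  have hnull : ∀ b ∈ J, Tendsto (fun n => (1 - e n) * b) atTop (𝓝 0) :=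
    fun b hb => he.tendsto_one_sub_mul hb
  have hbound : ∀ n, ‖1 - e n‖ ≤ 2 := fun n => norm_one_sub_le (he.norm_le n)
  -- One choice of averages must make all commutators and all displacements small simultaneously.
  let 𝒟 : Set (ℕ → M) := (fun x n => e n * x - x * e n) '' F ∪ (fun g n => γ.hom g (e n) - e n) '' K
  obtain ⟨N, k, hN, hk, hsum⟩ := exists_norm_sum_le (𝒟 := 𝒟) (C := 2 * R + 2) (by
    rintro d (⟨x, hx, rfl⟩ | ⟨g, hg, rfl⟩) n
    · have h₁ : ‖e n * x‖ ≤ 1 * R := (norm_mul_le _ _).trans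
        (mul_le_mul (he.norm_le n) (hR x hx) (norm_nonneg _) zero_le_one)
      have h₂ : ‖x * e n‖ ≤ R * 1 := (norm_mul_le _ _).trans
        (mul_le_mul (hR x hx) (he.norm_le n) (norm_nonneg _) hR0)
      exact (norm_sub_le _ _).trans (by linarith)
    · have h₁ := γ.norm_hom_le g (e n)
      have h₂ := he.norm_le n
      exact (norm_sub_le _ _).trans (by linarith)) (by
    intro m δ hδ
    have h₁ : ∀ᶠ n in atTop, ∀ x ∈ F, ‖star (e n * x - x * e n) * (e m * x - x * e m)‖ ≤ δ := by
      refine (Set.Finite.eventually_all hF).mpr fun x hx => ?_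
      have hb : e m * x - x * e m ∈ J :=
        sub_mem (hJ.mul_mem_right (he.mem m) x) (hJ.mul_mem_left x (he.mem m))
      -- For b in J, both x* e_n b and e_n x* b tend to x* b.
      have h₁ := ((he.tendsto_mul _ hb).const_mul (star x)).sub
        (he.tendsto_mul _ (hJ.mul_mem_left (star x) hb))
      rw [sub_self] at h₁
      have h₂ := h₁.norm
      rw [norm_zero] at h₂
      filter_upwards [h₂.eventually (ge_mem_nhds hδ)] with n hn
      simpa [sub_mul, mul_assoc, (he.isSelfAdjoint n).star_eq] using hn
    have hcont : Continuous fun g => γ.hom g (e m) - e m :=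
      (γ.continuous_hom _ (he.mem m)).sub continuous_const
    -- The term (1 - γ_g(e_n)) b has the norm of (1 - e_n) γ_{g⁻¹}(b), so the compactness estimate
    -- is also applied to the translated family.
    have hcont' : Continuous fun g => γ.hom g⁻¹ (γ.hom g (e m) - e m) := by
      simp only [map_sub, hom_inv_hom]
      exact continuous_const.sub ((γ.continuous_hom _ (he.mem m)).comp continuous_inv)
    have hmem : ∀ g, γ.hom g (e m) - e m ∈ J :=
      fun g => sub_mem (γ.hom_mem g (he.mem m)) (he.mem m)
    filter_upwards [h₁,
      eventually_norm_mul_le_of_isCompact hbound hnull hK hcont hmem (half_pos hδ),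
      eventually_norm_mul_le_of_isCompact hbound hnull hK hcont' (fun g => γ.hom_mem _ (hmem g))
        (half_pos hδ)] with n hn₁ hn₂ hn₃
    rintro d (⟨x, hx, rfl⟩ | ⟨g, hg, rfl⟩)
    · exact hn₁ x hx
    · have h₂ := hn₂ g hg
      have h₃ := hn₃ g hg
      rw [← γ.norm_hom g, map_mul, hom_hom_inv, map_sub, map_one] at h₃
      have hs : star (γ.hom g (e n) - e n) = (1 - e n) - (1 - γ.hom g (e n)) := by
        rw [star_sub, ← map_star, (he.isSelfAdjoint n).star_eq]
        abel
      simp only [hs]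
      rw [sub_mul]
      exact (norm_sub_le _ _).trans (by linarith)) N₀ hε
  have hN' : (0 : ℝ) < N := by exact_mod_cast hN
  have hnorm : ∀ (s : ℕ → M) (r : ℝ), ‖∑ j ∈ Finset.range N, s j‖ ≤ N * r →
      ‖(N : ℂ)⁻¹ • ∑ j ∈ Finset.range N, s j‖ ≤ r := fun s r h => by
    rw [norm_smul, norm_inv, Complex.norm_natCast, inv_mul_le_iff₀ hN']
    exact h
  have hconst : ∀ b : M, (N : ℂ)⁻¹ • ∑ _j ∈ Finset.range N, b = b := fun b => by
    have : (N : ℂ) ≠ 0 := by exact_mod_cast hN.ne'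
    rw [Finset.sum_const, Finset.card_range, ← Nat.cast_smul_eq_nsmul ℂ, smul_smul,
      inv_mul_cancel₀ this, one_smul]
  have hle : ∀ (s : ℕ → M) (r : ℝ), (∀ j, ‖s j‖ ≤ r) → ‖∑ j ∈ Finset.range N, s j‖ ≤ N * r :=
    fun s r h => (norm_sum_le_of_le _ fun j _ => h j).trans (by simp)
  refine ⟨(N : ℂ)⁻¹ • ∑ j ∈ Finset.range N, e (k j),
    SMulMemClass.smul_mem _ (sum_mem fun j _ => he.mem _), ?_,
    hnorm _ _ (hle _ _ fun j => he.norm_le _), fun x hx => ?_, fun g hg => ?_, fun b δ hb => ?_⟩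
  · rw [IsSelfAdjoint, star_smul, star_sum]
    simp [(he.isSelfAdjoint _).star_eq]
  · have h := hnorm _ _ (hsum _ (Or.inl ⟨x, hx, rfl⟩))
    simpa [Finset.sum_sub_distrib, smul_sub, Finset.sum_mul, Finset.mul_sum] using h
  · have h := hnorm _ _ (hsum _ (Or.inr ⟨g, hg, rfl⟩))
    simpa [Finset.sum_sub_distrib, smul_sub] using h
  · have h := hnorm (fun j => e (k j) * b - b) δ (hle _ _ fun j => hb _ (hk j))
    rw [Finset.sum_sub_distrib, smul_sub, hconst] at h
    simpa [Finset.sum_mul] using h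

/-- `p` is a norm-continuous quasicentral, asymptotically invariant approximate unit of `J` that
starts at `0`, with centrality measured against the elements of `S`. -/
structure IsQuasicentralPath (S : Set M) (p : ℝ≥0 → M) : Prop where
  continuous : Continuous p
  map_zero : p 0 = 0
  mem : ∀ t, p t ∈ J
  isSelfAdjoint : ∀ t, IsSelfAdjoint (p t)
  norm_le : ∀ t, ‖p t‖ ≤ 1
  tendsto_one_sub_mul : ∀ b ∈ J, Tendsto (fun t => (1 - p t) * b) atTop (𝓝 0)
  tendsto_commutator : ∀ x ∈ S, Tendsto (fun t => p t * x - x * p t) atTop (𝓝 0)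
  eventually_invariant : ∀ K : Set G, IsCompact K → ∀ ε > (0 : ℝ), ∀ᶠ t in atTop, ∀ g ∈ K,
    ‖γ.hom g (p t) - p t‖ ≤ ε

/-- Stage n treats finitely many x_j and the n-th set of a compact exhaustion with tolerance
1/(n+1). All conditions are convex, so linear interpolation preserves them, and a density argument
passes to the closure. -/
lemma exists_isQuasicentralPath [IsTopologicalGroup G] [LocallyCompactSpace G]
    [SigmaCompactSpace G] (hJ : IsClosedIdeal J) {e : ℕ → M} (he : IsApproxUnit J e) (x : ℕ → M) :
    ∃ p, γ.IsQuasicentralPath (closure (Set.range x)) p := by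
  let K : CompactExhaustion G := default
  have hpos : ∀ n : ℕ, (0 : ℝ) < 1 / ((n : ℝ) + 1) := fun n => Nat.one_div_pos_of_nat
  choose f hfJ hfsa hf1 hfx hfK hfb using fun n : ℕ => γ.exists_quasicentral hJ he
    ((Set.finite_Iic n).image x) (K.isCompact n) n (hpos n)
  -- Prepending 0 makes the path start at 0 and shifts the indices by one.
  let F : ℕ → M := fun n => Nat.casesOn n 0 f
  have hFmem : ∀ (n : ℕ) (C : Set M), (∀ k ≥ n, f k ∈ C) → ∀ k ≥ n + 1, F k ∈ C := by
    intro n C h k hk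
    obtain ⟨k, rfl⟩ : ∃ j, k = j + 1 := ⟨k - 1, by omega⟩
    exact h k (by omega)
  have hFall : ∀ C : Set M, 0 ∈ C → (∀ k, f k ∈ C) → ∀ k ≥ 0, F k ∈ C := by
    rintro C h₀ h (_ | k) -
    exacts [h₀, h k]
  obtain ⟨p, hpc, hp0, hp⟩ := exists_continuous_interpolation F
  have hball : ∀ (T : M →ₗ[ℝ] M) (c : M) (ε : ℝ) (n : ℕ), (∀ k ≥ n, ‖T (f k) - c‖ ≤ ε) →
      ∀ t : ℝ≥0, ((n + 1 : ℕ) : ℝ≥0) ≤ t → ‖T (p t) - c‖ ≤ ε := by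
    intro T c ε n h t ht
    have h₁ := hp (n + 1) (T ⁻¹' Metric.closedBall c ε)
      ((convex_closedBall c ε).linear_preimage T)
      (hFmem n _ fun k hk => by simpa [dist_eq_norm] using h k hk) t ht
    simpa [dist_eq_norm] using h₁
  have hsmall : ∀ ε > (0 : ℝ), ∃ n : ℕ, ∀ k ≥ n, 1 / ((k : ℝ) + 1) ≤ ε := fun ε hε =>
    eventually_atTop.mp
      ((tendsto_one_div_add_atTop_nhds_zero_nat (𝕜 := ℝ)).eventually (ge_mem_nhds hε))
  have hp1 : ∀ t, ‖p t‖ ≤ 1 := fun t => by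
    have := hp 0 (Metric.closedBall 0 1) (convex_closedBall _ _)
      (hFall _ (by simp) fun k => by simpa using hf1 k) t (by simp)
    simpa using this
  refine ⟨p, hpc, hp0, fun t => ?_, fun t => ?_, hp1, fun b hb => ?_, ?_, fun L hL ε hε => ?_⟩
  · exact hp 0 J (J.toSubmodule.restrictScalars ℝ).convex
      (hFall _ (zero_mem J) hfJ) t (by simp)
  · exact hp 0 (selfAdjoint.submodule ℝ M) (selfAdjoint.submodule ℝ M).convex
      (hFall _ (zero_mem (selfAdjoint.submodule ℝ M)) hfsa) t (by simp)
  · refine Metric.tendsto_nhds.mpr fun ε hε => ?_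
    have h₁ := tendsto_iff_norm_sub_tendsto_zero.mp (he.tendsto_mul b hb)
    obtain ⟨n, hn⟩ := eventually_atTop.mp (h₁.eventually (ge_mem_nhds (half_pos hε)))
    filter_upwards [eventually_ge_atTop ((n + 1 : ℕ) : ℝ≥0)] with t ht
    have h₂ := hball (LinearMap.mulRight ℝ b) b (ε / 2) n
      (fun k hk => hfb k b _ fun m hm => hn m (hk.trans hm)) t ht
    rw [dist_zero_right, sub_mul, one_mul, norm_sub_rev]
    exact lt_of_le_of_lt h₂ (by linarith)
  · have hrange : ∀ j, ∀ ε > 0, ∀ᶠ t in atTop, ‖p t * x j - x j * p t‖ ≤ ε := fun j ε hε => by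
      obtain ⟨n, hn⟩ := hsmall ε hε
      filter_upwards [eventually_ge_atTop ((max n j + 1 : ℕ) : ℝ≥0)] with t ht
      have := hball (LinearMap.mulRight ℝ (x j) - LinearMap.mulLeft ℝ (x j)) 0 ε (max n j)
        (fun k hk => by
          have h := hfx k (x j) ⟨j, (le_max_right n j).trans hk, rfl⟩
          simpa using h.trans (hn k ((le_max_left n j).trans hk))) t ht
      simpa using this
    intro y hy
    refine Metric.tendsto_nhds.mpr fun ε hε => ?_
    obtain ⟨_, ⟨j, rfl⟩, hj⟩ := Metric.mem_closure_iff.mp hy (ε / 4) (by positivity)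
    rw [dist_eq_norm] at hj
    filter_upwards [hrange j (ε / 4) (by positivity)] with t ht
    have h₁ : ‖p t * (y - x j)‖ ≤ 1 * ‖y - x j‖ :=
      (norm_mul_le _ _).trans (mul_le_mul_of_nonneg_right (hp1 t) (norm_nonneg _))
    have h₂ : ‖(y - x j) * p t‖ ≤ ‖y - x j‖ * 1 :=
      (norm_mul_le _ _).trans (mul_le_mul_of_nonneg_left (hp1 t) (norm_nonneg _))
    rw [dist_zero_right]
    calc ‖p t * y - y * p t‖
        = ‖p t * (y - x j) - (y - x j) * p t + (p t * x j - x j * p t)‖ := by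
          congr 1; noncomm_ring
      _ ≤ ‖p t * (y - x j)‖ + ‖(y - x j) * p t‖ + ‖p t * x j - x j * p t‖ :=
        (norm_add_le _ _).trans (add_le_add_left (norm_sub_le _ _) _)
      _ < ε := by linarith
  · obtain ⟨m, hm⟩ := K.exists_superset_of_isCompact hL
    obtain ⟨n, hn⟩ := hsmall ε hε
    filter_upwards [eventually_ge_atTop ((max n m + 1 : ℕ) : ℝ≥0)] with t ht g hg
    have := hball (((γ.hom g).toAlgHom.toLinearMap.restrictScalars ℝ) - LinearMap.id) 0 ε (max n m)
      (fun k hk => by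
        have h := hfK k g (K.subset ((le_max_right n m).trans hk) (hm hg))
        simpa using h.trans (hn k ((le_max_left n m).trans hk))) t ht
    simpa using this

/-- The path `x` asymptotically commutes with the elements of `S` and is asymptotically invariant,
uniformly on compact sets. -/
structure IsAsymptoticallyFixed (S : Set M) (x : ℝ≥0 → M) : Prop where
  tendsto_commutator : ∀ y ∈ S, Tendsto (fun t => ‖x t * y - y * x t‖) atTop (𝓝 0)
  eventually_invariant : ∀ K : Set G, IsCompact K → ∀ ε > (0 : ℝ), ∀ᶠ t in atTop, ∀ g ∈ K,
    ‖x t - γ.hom g (x t)‖ ≤ ε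

/-- The unitary `w` is the initial point of an asymptotically fixed path of unitaries inside
`w + J`. -/
def HasFixedPath (S : Set M) (w : unitary M) : Prop :=
  ∃ x : ℝ≥0 → unitary M, Continuous x ∧ x 0 = w ∧ (∀ t, (x t : M) - w ∈ J) ∧
    γ.IsAsymptoticallyFixed S fun t => (x t : M)

variable {γ} {S : Set M}

lemma hasFixedPath_one : γ.HasFixedPath S 1 :=
  ⟨fun _ => 1, continuous_const, rfl, fun t => by simp,
    fun y _ => by simp, fun K _ ε hε => Eventually.of_forall fun t g _ => by simpa using hε.le⟩

/-- Commutators and displacements obey a Leibniz rule, and the remaining factors are contractions.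
-/
lemma HasFixedPath.mul (hJ : IsClosedIdeal J) {v w : unitary M} (hv : γ.HasFixedPath S v)
    (hw : γ.HasFixedPath S w) : γ.HasFixedPath S (v * w) := by
  obtain ⟨x, hxc, hx0, hxJ, hx⟩ := hv
  obtain ⟨y, hyc, hy0, hyJ, hy⟩ := hw
  refine ⟨fun t => x t * y t, hxc.mul hyc, by simp [hx0, hy0], fun t => ?_, fun z hz => ?_,
    fun K hK ε hε => ?_⟩
  · have h := add_mem (hJ.mul_mem_left (x t : M) (hyJ t)) (hJ.mul_mem_right (hxJ t) (w : M))
    convert h using 1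
    push_cast
    noncomm_ring
  · refine squeeze_zero (fun _ => norm_nonneg _) (fun t => ?_)
      (by simpa using (hx.tendsto_commutator z hz).add (hy.tendsto_commutator z hz))
    have hsplit : ((x t * y t : unitary M) : M) * z - z * ((x t * y t : unitary M) : M) =
        (x t * z - z * x t) * y t + x t * (y t * z - z * y t) := by
      push_cast
      noncomm_ring
    rw [hsplit]
    exact (norm_add_le _ _).trans
      (by rw [CStarRing.norm_mul_coe_unitary, CStarRing.norm_coe_unitary_mul])
  · filter_upwards [hx.eventually_invariant K hK _ (half_pos hε),
      hy.eventually_invariant K hK _ (half_pos hε)] with t h₁ h₂ g hg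
    have hsplit : ((x t * y t : unitary M) : M) - γ.hom g ((x t * y t : unitary M) : M) =
        x t * (y t - γ.hom g (y t)) + (x t - γ.hom g (x t)) * γ.hom g (y t) := by
      push_cast
      rw [map_mul]
      noncomm_ring
    rw [hsplit]
    have h₃ : ‖(x t - γ.hom g (x t)) * γ.hom g (y t)‖ ≤ ε / 2 * 1 := (norm_mul_le _ _).trans
      (mul_le_mul (h₁ g hg) ((γ.norm_hom_le g _).trans (norm_unitary_le (y t)))
        (norm_nonneg _) (half_pos hε).le)
    refine (norm_add_le _ _).trans ?_
    rw [CStarRing.norm_coe_unitary_mul]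
    linarith [h₂ g hg]

/-! ### Compression by 1 - p_t and its exponential -/

section Compression

variable {p : ℝ≥0 → M}

lemma IsQuasicentralPath.norm_one_sub_le (hp : γ.IsQuasicentralPath S p) (t : ℝ≥0) : ‖1 - p t‖ ≤ 2 :=
  CocycleRepresentations.norm_one_sub_le (hp.norm_le t)

lemma IsQuasicentralPath.norm_compression_le (hp : γ.IsQuasicentralPath S p) (h : M)
    (t : ℝ≥0) :
    ‖(1 - p t) * h * (1 - p t)‖ ≤ 4 * ‖h‖ := by
  have hq := hp.norm_one_sub_le t
  calc _ ≤ ‖1 - p t‖ * ‖h‖ * ‖1 - p t‖ := norm_mul₃_le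
    _ ≤ 2 * ‖h‖ * 2 := by gcongr
    _ = 4 * ‖h‖ := by ring

/-- Elements that are fixed modulo `J` become asymptotically fixed after compression by
`1 - p t`. -/
lemma IsQuasicentralPath.isAsymptoticallyFixed_compression [IsTopologicalGroup G] [BaireSpace G]
    (hp : γ.IsQuasicentralPath S p) (hJ : IsClosedIdeal J) {e : ℕ → M} (he : IsApproxUnit J e) {h : M}
    (hγ : ∀ g, h - γ.hom g h ∈ J) (hS : ∀ y ∈ S, h * y - y * h ∈ J) :
    γ.IsAsymptoticallyFixed S fun t => (1 - p t) * h * (1 - p t) := by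
  refine ⟨fun y hy => ?_, fun K hK ε hε => ?_⟩
  · have h₁ := (hp.tendsto_commutator y hy).norm
    have h₂ := (hp.tendsto_one_sub_mul _ (hS y hy)).norm
    rw [norm_zero] at h₁ h₂
    have h₃ := ((h₁.const_mul (2 * ‖h‖)).add (h₂.mul_const 2)).add (h₁.mul_const (‖h‖ * 2))
    simp only [mul_zero, zero_mul, add_zero] at h₃
    refine squeeze_zero (fun _ => norm_nonneg _) (fun t => ?_) h₃
    have hq := hp.norm_one_sub_le t
    -- Each term contains either [p_t, y] or 1 - p_t next to [h, y] ∈ J.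
    have hsplit : (1 - p t) * h * (1 - p t) * y - y * ((1 - p t) * h * (1 - p t)) =
        -((1 - p t) * h * (p t * y - y * p t)) + (1 - p t) * (h * y - y * h) * (1 - p t) -
          (p t * y - y * p t) * (h * (1 - p t)) := by
      noncomm_ring
    rw [hsplit]
    refine (norm_sub_le _ _).trans (add_le_add ((norm_add_le _ _).trans (add_le_add ?_ ?_)) ?_)
    · rw [norm_neg]
      refine norm_mul₃_le.trans ?_
      gcongr
    · refine (norm_mul_le _ _).trans ?_
      gcongr
    · refine (norm_mul_le _ _).trans ?_
      gcongr
      refine (norm_mul_le _ _).trans ?_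
      gcongr
  · have hcont := γ.continuous_sub_hom hJ he hγ
    -- The three terms of the splitting below contribute 2‖h‖, 2 and 2‖h‖ times this tolerance.
    have hδ : 0 < ε / (4 * ‖h‖ + 2) := by positivity
    filter_upwards [hp.eventually_invariant K hK _ hδ,
      eventually_norm_mul_le_of_isCompact hp.norm_one_sub_le hp.tendsto_one_sub_mul hK hcont hγ
        hδ] with t h₁ h₂ g hg
    have hq := hp.norm_one_sub_le t
    have hγq : ‖1 - γ.hom g (p t)‖ ≤ 2 :=
      CocycleRepresentations.norm_one_sub_le ((γ.norm_hom_le g _).trans (hp.norm_le t))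
    have hγh := γ.norm_hom_le g h
    have h₁' := h₁ g hg
    have h₂' := h₂ g hg
    have hsplit : (1 - p t) * h * (1 - p t) - γ.hom g ((1 - p t) * h * (1 - p t)) =
        (1 - p t) * h * (γ.hom g (p t) - p t) +
          (1 - p t) * (h - γ.hom g h) * (1 - γ.hom g (p t)) +
          (γ.hom g (p t) - p t) * γ.hom g h * (1 - γ.hom g (p t)) := by
      simp only [map_mul, map_sub, map_one]
      noncomm_ring
    rw [hsplit]
    calc _ ≤ 2 * ‖h‖ * (ε / (4 * ‖h‖ + 2)) + ε / (4 * ‖h‖ + 2) * 2 +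
          ε / (4 * ‖h‖ + 2) * ‖h‖ * 2 := by
          refine (norm_add_le _ _).trans (add_le_add ((norm_add_le _ _).trans (add_le_add ?_ ?_)) ?_)
          · refine norm_mul₃_le.trans ?_
            gcongr
          · refine (norm_mul_le _ _).trans ?_
            gcongr
          · refine norm_mul₃_le.trans ?_
            gcongr
      _ = ε := by field_simp; ring

lemma IsQuasicentralPath.hasFixedPath_expUnitary [IsTopologicalGroup G] [BaireSpace G]
    (hp : γ.IsQuasicentralPath S p) (hJ : IsClosedIdeal J) {e : ℕ → M} (he : IsApproxUnit J e) (h : selfAdjoint M)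
    (hγ : ∀ g, (h : M) - γ.hom g h ∈ J) (hS : ∀ y ∈ S, (h : M) * y - y * h ∈ J) :
    γ.HasFixedPath S (selfAdjoint.expUnitary h) := by
  have hfix := hp.isAsymptoticallyFixed_compression hJ he hγ hS
  have hbound := hp.norm_compression_le (h : M)
  have hsa : ∀ t, IsSelfAdjoint ((1 - p t) * (h : M) * (1 - p t)) := fun t => by
    have h₁ : IsSelfAdjoint (1 - p t) := (IsSelfAdjoint.one M).sub (hp.isSelfAdjoint t)
    simpa [h₁.star_eq] using h.2.conjugate (1 - p t)
  let X : ℝ≥0 → selfAdjoint M := fun t => ⟨_, hsa t⟩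
  have hXc : Continuous X := by
    have := hp.continuous
    exact Continuous.subtype_mk (by fun_prop) _
  have hnorm : ∀ t, ‖Complex.I • (X t : M)‖ ≤ 4 * ‖(h : M)‖ := fun t => by
    rw [norm_smul, Complex.norm_I, one_mul]
    exact hbound t
  refine ⟨fun t => selfAdjoint.expUnitary (X t), selfAdjoint.continuous_expUnitary.comp hXc, ?_,
    fun t => ?_, fun y hy => ?_, fun K hK ε hε => ?_⟩
  · exact Subtype.ext (by simp [X, hp.map_zero])
  · simp only [selfAdjoint.expUnitary_coe]
    refine hJ.exp_sub_exp_mem ?_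
    rw [← smul_sub]
    refine SMulMemClass.smul_mem _ ?_
    -- Here (1-p)h(1-p) - h = ph(p-1) - hp.
    have h₁ := sub_mem (hJ.mul_mem_right (hJ.mul_mem_right (hp.mem t) (h : M)) (p t - 1))
      (hJ.mul_mem_left (h : M) (hp.mem t))
    convert h₁ using 1
    simp only [X]
    noncomm_ring
  · have h₁ := (hfix.tendsto_commutator y hy).const_mul (Real.exp (4 * ‖(h : M)‖))
    rw [mul_zero] at h₁
    refine squeeze_zero (fun _ => norm_nonneg _) (fun t => ?_) h₁
    simp only [selfAdjoint.expUnitary_coe]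
    refine (norm_exp_mul_sub_mul_exp_le y (hnorm t) (hnorm t)).trans (le_of_eq ?_)
    rw [smul_mul_assoc, mul_smul_comm, ← smul_sub, norm_smul, Complex.norm_I, one_mul]
  · have hE := Real.exp_pos (4 * ‖(h : M)‖)
    filter_upwards [hfix.eventually_invariant K hK _ (div_pos hε hE)] with t ht g hg
    let +nondep : NormedAlgebra ℚ M := .restrictScalars ℚ ℂ M
    have hmap : γ.hom g (NormedSpace.exp (Complex.I • (X t : M))) =
        NormedSpace.exp (Complex.I • γ.hom g (X t : M)) := by
      rw [NormedSpace.map_exp _ (map_continuous (γ.hom g)), map_smul]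
    have hnorm' : ‖Complex.I • γ.hom g (X t : M)‖ ≤ 4 * ‖(h : M)‖ := by
      rw [← map_smul]
      exact (γ.norm_hom_le g _).trans (hnorm t)
    have h₁ := norm_exp_mul_sub_mul_exp_le 1 (hnorm t) hnorm'
    simp only [mul_one, one_mul, ← smul_sub, norm_smul, Complex.norm_I] at h₁
    simp only [selfAdjoint.expUnitary_coe]
    rw [hmap]
    refine h₁.trans ?_
    rw [← le_div_iff₀' hE]
    exact ht g hg

end Compression

end IdealAction

end Action

/-! ### Multiplier algebras and the perturbed action -/

section Concrete

variable {G : Type*} [Group G] [TopologicalSpace G]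
variable {A : Type*} [NonUnitalCStarAlgebra A] {B : Type*} [NonUnitalCStarAlgebra B]

lemma isometry_coeHom : Isometry (DoubleCentralizer.coeHom (𝕜 := ℂ) (A := B)) :=
  AddMonoidHomClass.isometry_of_norm _ fun b => by
    rw [← DoubleCentralizer.norm_fst]
    exact ContinuousLinearMap.opNorm_mul_apply ℂ B b

lemma isClosedIdeal_baseIdeal : IsClosedIdeal (baseIdeal B) where
  isClosed := by
    have h := (isometry_coeHom (B := B)).isClosedEmbedding.isClosed_range
    convert h
    ext x
    simp [baseIdeal]
  mul_mem_left x _ hy := mul_mem_baseIdeal x hy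
  mul_mem_right hy x := mem_baseIdeal_mul hy x

lemma exists_isApproxUnit (hB : IsSigmaUnital B) : ∃ e, IsApproxUnit (baseIdeal B) e := by
  let := CStarAlgebra.spectralOrder B
  have := CStarAlgebra.spectralOrderedRing B
  obtain ⟨e, -, he, hlim⟩ := hB
  refine ⟨fun n => DoubleCentralizer.coeHom (𝕜 := ℂ) (e n), fun n => ⟨e n, rfl⟩, fun n => ?_,
    fun n => ?_, ?_⟩
  · exact (IsSelfAdjoint.of_nonneg (he n).1).map _
  · rw [(isometry_coeHom (B := B)).norm_map_of_map_zero (map_zero _)]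
    exact (he n).2
  · rintro _ ⟨b, rfl⟩
    have h := (isometry_coeHom (B := B)).continuous.continuousAt.tendsto.comp (hlim b).1
    exact h.congr fun n => map_mul _ _ _

namespace CocycleRep

variable {α : ContAction G A} {β : ContAction G B}

lemma multiplierExt_coeHom (σ : B ≃⋆ₐ[ℂ] B) (b : B) :
    multiplierExt σ (DoubleCentralizer.coeHom (𝕜 := ℂ) b) = DoubleCentralizer.coeHom (𝕜 := ℂ) (σ b) :=
  multiplier_ext
    (fun c => by
      change σ (b * σ.symm c) = σ b * c
      simp)
    (fun c => by
      change σ (σ.symm c * b) = c * σ b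
      simp)

lemma mul_coeHom (x : 𝓜(ℂ, B)) (b : B) :
    x * DoubleCentralizer.coeHom (𝕜 := ℂ) b = DoubleCentralizer.coeHom (𝕜 := ℂ) (x.fst b) := by
  refine multiplier_ext (fun c => ?_) (fun c => x.central c b)
  change x.fst (b * c) = x.fst b * c
  rw [eq_comm, ← sub_eq_zero, ← CStarRing.star_mul_self_eq_zero_iff]
  generalize star (x.fst b * c - x.fst (b * c)) = d
  rw [mul_sub, ← mul_assoc, ← x.central, ← x.central, mul_assoc, sub_self]

lemma multiplierExt_one (x : 𝓜(ℂ, B)) : multiplierExt (1 : B ≃⋆ₐ[ℂ] B) x = x :=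
  multiplier_ext (fun _ => rfl) (fun _ => rfl)

lemma multiplierExt_mul (σ τ : B ≃⋆ₐ[ℂ] B) (x : 𝓜(ℂ, B)) :
    multiplierExt (σ * τ) x = multiplierExt σ (multiplierExt τ x) :=
  multiplier_ext (fun _ => rfl) (fun _ => rfl)

lemma coc_one (ρ : CocycleRep α β) : (ρ.coc 1 : 𝓜(ℂ, B)) = 1 := by
  have h := ρ.coc_mul 1 1
  rw [mul_one, map_one, multiplierExt_one] at h
  have h' : ρ.coc 1 = ρ.coc 1 * ρ.coc 1 := Subtype.ext h
  rw [left_eq_mul.mp h']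
  rfl

/-- The cocycle perturbed action as an action on the multiplier algebra. -/
def perturbedAction (ρ : CocycleRep α β) : IdealAction G (baseIdeal B) where
  hom g :=
    { toFun := ρ.perturbed g
      map_one' := by simpa using ρ.perturbed_algebraMap g 1
      map_mul' := ρ.perturbed_mul g
      map_zero' := by simp [perturbed]
      map_add' := ρ.perturbed_add g
      commutes' := ρ.perturbed_algebraMap g
      map_star' := ρ.perturbed_star g }
  hom_one x := by
    change ρ.perturbed 1 x = x
    rw [perturbed, coc_one, one_mul, star_one, mul_one, map_one, multiplierExt_one]
  hom_mul g h x := by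
    change ρ.perturbed (g * h) x = ρ.perturbed g (ρ.perturbed h x)
    simp only [perturbed, ρ.coc_mul, multiplierExt_mul, map_mul, map_star, star_mul, mul_assoc]
  hom_mem g x hx := by
    obtain ⟨b, rfl⟩ := hx
    change ρ.perturbed g (DoubleCentralizer.coeHom (𝕜 := ℂ) b) ∈ baseIdeal B
    rw [perturbed, multiplierExt_coeHom]
    exact mem_baseIdeal_mul (mul_mem_baseIdeal _ ⟨_, rfl⟩) _
  continuous_hom := by
    rintro _ ⟨b, rfl⟩
    have hmul : ∀ y : G → 𝓜(ℂ, B), Continuous y → (∀ g, y g ∈ baseIdeal B) →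
        Continuous fun g => (ρ.coc g : 𝓜(ℂ, B)) * y g := fun y hy hyJ =>
      continuous_apply_of_contractive (S := baseIdeal B) (T := fun g x => (ρ.coc g : 𝓜(ℂ, B)) * x)
        (fun g a b => by
          rw [dist_eq_norm, dist_eq_norm, ← mul_sub, CStarRing.norm_coe_unitary_mul])
        (by
          rintro _ ⟨b, rfl⟩
          have h := isometry_coeHom.continuous.comp (ρ.continuous_coc_mul b)
          exact h.congr fun g => (mul_coeHom _ b).symm)
        hy hyJ
    have h₁ : Continuous fun g => (ρ.coc g : 𝓜(ℂ, B)) *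
        DoubleCentralizer.coeHom (𝕜 := ℂ) (β.aut g b) :=
      hmul _ (isometry_coeHom.continuous.comp (β.continuous_orbit b)) fun g => ⟨_, rfl⟩
    have h₂ := (hmul _ h₁.star fun g => star_mem (mul_mem_baseIdeal _ ⟨_, rfl⟩)).star
    refine h₂.congr fun g => ?_
    change _ = ρ.perturbed g (DoubleCentralizer.coeHom (𝕜 := ℂ) b)
    rw [perturbed, multiplierExt_coeHom, star_mul, star_star]

lemma perturbedAction_hom (ρ : CocycleRep α β) (g : G) (x : 𝓜(ℂ, B)) :
    ρ.perturbedAction.hom g x = (ρ.coc g : 𝓜(ℂ, B)) * multiplierExt (β.aut g) x *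
      star (ρ.coc g : 𝓜(ℂ, B)) := rfl

/-- Closedness makes D a C⋆-algebra, so exponentials of its selfadjoint elements stay in D and
generate the identity component of its unitary group. -/
instance isClosed_dAlg (ρ : CocycleRep α β) : IsClosed (ρ.dAlg : Set 𝓜(ℂ, B)) := by
  have hJ := (isClosedIdeal_baseIdeal (B := B)).isClosed
  have h : (ρ.dAlg : Set 𝓜(ℂ, B)) =
      (⋂ g : G, (fun x => x - ρ.perturbedAction.hom g x) ⁻¹' (baseIdeal B : Set 𝓜(ℂ, B))) ∩
        ⋂ a : A, (fun x => x * ρ.hom a - ρ.hom a * x) ⁻¹' (baseIdeal B : Set 𝓜(ℂ, B)) := by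
    ext x
    simp only [Set.mem_inter_iff, Set.mem_iInter]
    rfl
  rw [h]
  refine (isClosed_iInter fun g => hJ.preimage ?_).inter (isClosed_iInter fun a => hJ.preimage ?_)
  · exact continuous_id.sub (map_continuous (ρ.perturbedAction.hom g))
  · fun_prop

lemma hasFixedPath_of_mem_connectedComponent [IsTopologicalGroup G] [BaireSpace G]
    (hB : IsSigmaUnital B) (ρ : CocycleRep α β) {p : ℝ≥0 → 𝓜(ℂ, B)}
    (hp : ρ.perturbedAction.IsQuasicentralPath (Set.range ρ.hom) p) {w : unitary ρ.dAlg}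
    (hw : w ∈ connectedComponent (1 : unitary ρ.dAlg)) :
    ρ.perturbedAction.HasFixedPath (Set.range ρ.hom) (unitaryMap ρ.dAlg.subtype w) := by
  obtain ⟨e, he⟩ := exists_isApproxUnit hB
  rw [← pathComponent_eq_connectedComponent, Unitary.mem_pathComponentOne_iff] at hw
  obtain ⟨l, rfl⟩ := hw
  induction l with
  | nil => simpa using IdealAction.hasFixedPath_one
  | cons h l ih =>
    rw [List.map_cons, List.prod_cons, map_mul]
    refine IdealAction.HasFixedPath.mul isClosedIdeal_baseIdeal ?_ ih
    let h' : selfAdjoint 𝓜(ℂ, B) := ⟨((h : ρ.dAlg) : 𝓜(ℂ, B)), congrArg Subtype.val h.2⟩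
    have hexp : unitaryMap ρ.dAlg.subtype (selfAdjoint.expUnitary h) = selfAdjoint.expUnitary h' := by
      let +nondep : NormedAlgebra ℚ 𝓜(ℂ, B) := .restrictScalars ℚ ℂ _
      let +nondep : NormedAlgebra ℚ ρ.dAlg := .restrictScalars ℚ ℂ _
      refine Subtype.ext ?_
      change ρ.dAlg.subtype (NormedSpace.exp (Complex.I • (h : ρ.dAlg))) = _
      rw [NormedSpace.map_exp _ continuous_subtype_val]
      rfl
    rw [hexp]
    refine hp.hasFixedPath_expUnitary isClosedIdeal_baseIdeal he h' (h : ρ.dAlg).2.1 ?_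
    rintro _ ⟨a, rfl⟩
    exact (h : ρ.dAlg).2.2 a

end CocycleRep

/-- A path of unitaries of the multiplier algebra inside `1 + B` lifts to the unitization. -/
lemma exists_unitization_lift {x : ℝ≥0 → unitary 𝓜(ℂ, B)} (hx : Continuous x) (hx0 : x 0 = 1)
    (hxJ : ∀ t, (x t : 𝓜(ℂ, B)) - 1 ∈ baseIdeal B) :
    ∃ w : ℝ≥0 → unitary (Unitization ℂ B), Continuous w ∧ (∀ t, w t ∈ unitariesOnePlus B) ∧
      w 0 = 1 ∧ ∀ t, unitizationToMultiplier B (w t) = x t := by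
  choose b hb using hxJ
  replace hb : ∀ t, DoubleCentralizer.coeHom (𝕜 := ℂ) (b t) = (x t : 𝓜(ℂ, B)) - 1 := hb
  have hinj : Function.Injective (DoubleCentralizer.coeHom (𝕜 := ℂ) (A := B)) :=
    isometry_coeHom.injective
  have hbc : Continuous b := by
    refine (isometry_coeHom (B := B)).isEmbedding.continuous_iff.mpr ?_
    have h : Continuous fun t => (x t : 𝓜(ℂ, B)) - 1 := by fun_prop
    exact h.congr fun t => (hb t).symm
  -- The unitization does not embed in M(B) when B is unital, so unitarity is reduced to identities
  -- in B itself, which does embed.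
  have hu : ∀ t, (1 + (b t : Unitization ℂ B)) ∈ unitary (Unitization ℂ B) := fun t => by
    have h₁ : star (b t) + b t + star (b t) * b t = 0 := hinj (by
      have h : star (x t : 𝓜(ℂ, B)) * x t = 1 := Unitary.coe_star_mul_self (x t)
      rw [map_zero, map_add, map_add, map_mul, map_star, hb, star_sub, star_one, mul_sub, sub_mul,
        h]
      noncomm_ring)
    have h₂ : star (b t) + b t + b t * star (b t) = 0 := hinj (by
      have h : (x t : 𝓜(ℂ, B)) * star (x t : 𝓜(ℂ, B)) = 1 := Unitary.coe_mul_star_self (x t)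
      rw [map_zero, map_add, map_add, map_mul, map_star, hb, star_sub, star_one, mul_sub, sub_mul,
        h]
      noncomm_ring)
    have h₁' := congrArg (fun c : B => (c : Unitization ℂ B)) h₁
    have h₂' := congrArg (fun c : B => (c : Unitization ℂ B)) h₂
    simp only [Unitization.inr_add, Unitization.inr_mul, Unitization.inr_star,
      Unitization.inr_zero] at h₁' h₂'
    rw [Unitary.mem_iff, star_add, star_one]
    constructor
    · calc _ = 1 + (star (b t : Unitization ℂ B) + b t + star (b t : Unitization ℂ B) * b t) := by
            noncomm_ring
        _ = 1 := by rw [h₁', add_zero]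
    · calc _ = 1 + (star (b t : Unitization ℂ B) + b t + b t * star (b t : Unitization ℂ B)) := by
            noncomm_ring
        _ = 1 := by rw [h₂', add_zero]
  refine ⟨fun t => ⟨_, hu t⟩, ?_, fun t => ?_, ?_, fun t => ?_⟩
  · refine Continuous.subtype_mk (continuous_const.add ?_) _
    exact (Unitization.isometry_inr (𝕜 := ℂ) (A := B)).continuous.comp hbc
  · simp [unitariesOnePlus]
  · have h0 : b 0 = 0 := hinj (by rw [hb, hx0, map_zero]; simp)
    exact Subtype.ext (by simp [h0])
  · change unitizationToMultiplier B (1 + (b t : Unitization ℂ B)) = x t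
    have h : unitizationToMultiplier B (b t : Unitization ℂ B) =
        DoubleCentralizer.coeHom (𝕜 := ℂ) (b t) :=
      Unitization.starLift_symm_apply_apply (Unitization.starLift _) (b t) |>.symm.trans (by
        rw [Equiv.symm_apply_apply])
    rw [map_add, map_one, h, hb, add_sub_cancel]

end Concrete

end CocycleRepresentations

end

/-! ### The main theorem -/

open CocycleRepresentations in
theorem corollary4p5
    {G : Type*} [Group G] [TopologicalSpace G] [IsTopologicalGroup G]
    [LocallyCompactSpace G] [SecondCountableTopology G]
    {A : Type*} [NonUnitalCStarAlgebra A] [TopologicalSpace.SeparableSpace A]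
    {B : Type*} [NonUnitalCStarAlgebra B] (hB : IsSigmaUnital B)
    (α : ContAction G A) (β : ContAction G B)
    (ρ₀ ρ₁ : CocycleRep α β) (h : ρ₀.OperatorHomotopic ρ₁) :
    ρ₀.StronglyAsymptoticallyUnitarilyEquivalent ρ₁ := by
  obtain ⟨w, hw, hhom, hcoc⟩ := h
  obtain ⟨e, he⟩ := exists_isApproxUnit hB
  obtain ⟨p, hp⟩ := ρ₀.perturbedAction.exists_isQuasicentralPath isClosedIdeal_baseIdeal he
    (fun n => ρ₀.hom (TopologicalSpace.denseSeq A n))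
  have hsub : Set.range ρ₀.hom ⊆ closure
      (Set.range fun n => ρ₀.hom (TopologicalSpace.denseSeq A n)) := by
    rintro _ ⟨a, rfl⟩
    change _ ∈ closure (Set.range (ρ₀.hom ∘ TopologicalSpace.denseSeq A))
    rw [Set.range_comp]
    exact image_closure_subset_closure_image (AddMonoidHomClass.continuous_of_bound ρ₀.hom 1 fun a => by
      simpa using NonUnitalStarAlgHom.norm_apply_le ρ₀.hom a)
      ⟨a, TopologicalSpace.denseRange_denseSeq A a, rfl⟩
  have hp' : ρ₀.perturbedAction.IsQuasicentralPath (Set.range ρ₀.hom) p :=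
    { hp with tendsto_commutator := fun x hx => hp.tendsto_commutator x (hsub hx) }
  -- The path is started at w⁻¹ so that multiplying it by w on the left gives a path from 1 inside 1
  -- + B.
  have hwinv : w⁻¹ ∈ connectedComponent (1 : unitary ρ₀.dAlg) :=
    (Subgroup.connectedComponentOfOne (unitary ρ₀.dAlg)).inv_mem hw
  obtain ⟨x, hxc, hx0, hxJ, hx⟩ := ρ₀.hasFixedPath_of_mem_connectedComponent hB hp' hwinv
  rw [map_inv] at hx0 hxJ
  set v : unitary 𝓜(ℂ, B) := unitaryMap ρ₀.dAlg.subtype w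
  have hvw : ((w : ρ₀.dAlg) : 𝓜(ℂ, B)) = (v : 𝓜(ℂ, B)) := rfl
  obtain ⟨W, hWc, hW1, hW0, hWx⟩ := exists_unitization_lift (x := fun t => v * x t)
    (continuous_const.mul hxc) (by simp [hx0]) (fun t => by
      have h₁ := mul_mem_baseIdeal (v : 𝓜(ℂ, B)) (hxJ t)
      have hvv : (v : 𝓜(ℂ, B)) * ((v⁻¹ : unitary 𝓜(ℂ, B)) : 𝓜(ℂ, B)) = 1 :=
        Unitary.coe_mul_star_self v
      rw [mul_sub, hvv] at h₁
      exact h₁)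
  have hvs : ∀ u : unitary 𝓜(ℂ, B), (u : 𝓜(ℂ, B)) * star (u : 𝓜(ℂ, B)) = 1 :=
    Unitary.coe_mul_star_self
  refine ⟨W, hWc, hW1, hW0, fun a => ?_, fun K hK ε hε => ?_⟩
  · refine (hx.tendsto_commutator _ ⟨a, rfl⟩).congr fun t => ?_
    rw [hWx, hhom, hvw]
    have hsplit : (v : 𝓜(ℂ, B)) * ρ₀.hom a * star (v : 𝓜(ℂ, B)) -
        ((v * x t : unitary 𝓜(ℂ, B)) : 𝓜(ℂ, B)) * ρ₀.hom a *
          star ((v * x t : unitary 𝓜(ℂ, B)) : 𝓜(ℂ, B)) =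
        v * (-(x t * ρ₀.hom a - ρ₀.hom a * x t) * (star (x t) : unitary 𝓜(ℂ, B))) *
          (star v : unitary 𝓜(ℂ, B)) := by
      have h₁ := hvs (x t)
      push_cast
      rw [star_mul, neg_sub, sub_mul, mul_assoc (ρ₀.hom a), h₁]
      noncomm_ring
    rw [hsplit, CStarRing.norm_mul_coe_unitary, CStarRing.norm_coe_unitary_mul,
      CStarRing.norm_mul_coe_unitary, norm_neg]
  · filter_upwards [hx.eventually_invariant K hK (ε / 2) (half_pos hε)] with t ht g hg
    refine lt_of_le_of_lt (le_trans (le_of_eq ?_) (ht g hg)) (half_lt_self hε)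
    let β' : unitary 𝓜(ℂ, B) →* unitary 𝓜(ℂ, B) := unitaryMap (multiplierExt (β.aut g))
    have hβ : ∀ u : unitary 𝓜(ℂ, B), multiplierExt (β.aut g) (u : 𝓜(ℂ, B)) = β' u := fun _ => rfl
    have hu : star (ρ₀.coc g : 𝓜(ℂ, B)) * (ρ₀.coc g : 𝓜(ℂ, B)) = 1 := Unitary.coe_star_mul_self _
    rw [hWx, hcoc, hvw, CocycleRep.perturbedAction_hom, hβ, hβ, hβ, map_mul]
    -- Here `v` is w viewed in M(B). Inserting u_g* u_g = 1 exposes the displacement of x_t between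
    -- unitaries.
    have hsplit : (v : 𝓜(ℂ, B)) * ρ₀.coc g * star (β' v : 𝓜(ℂ, B)) -
        ((v * x t : unitary 𝓜(ℂ, B)) : 𝓜(ℂ, B)) * ρ₀.coc g *
          star ((β' v * β' (x t) : unitary 𝓜(ℂ, B)) : 𝓜(ℂ, B)) =
        v * (-(x t - ρ₀.coc g * β' (x t) * star (ρ₀.coc g : 𝓜(ℂ, B))) * ρ₀.coc g *
          (star (β' (x t)) : unitary 𝓜(ℂ, B))) * (star (β' v) : unitary 𝓜(ℂ, B)) := by
      have h₁ := hvs (β' (x t))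
      push_cast
      rw [star_mul, neg_sub, sub_mul _ _ (ρ₀.coc g : 𝓜(ℂ, B)), mul_assoc _ (star _), hu, mul_one,
        sub_mul, mul_assoc (ρ₀.coc g : 𝓜(ℂ, B)) _ (star _), h₁]
      noncomm_ring
    rw [hsplit, CStarRing.norm_mul_coe_unitary, CStarRing.norm_coe_unitary_mul,
      CStarRing.norm_mul_coe_unitary, CStarRing.norm_mul_coe_unitary, norm_neg]
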